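/- For $t,p\ge 0$ let $F_{t,p}$ be the graph on $t+p+4$ vertices $a,b,c,d,x_1,\dots,x_t,y_1,\dots,y_p$ in which $a$ is adjacent to $c,x_1,\dots,x_t$, the vertex $b$ is adjacent to $c,y_1,\dots,y_p$, and there are no other edges (so $c$ is a common neighbour of $a$ and $b$, and $d$ is isolated). A class $\mathcal X$ of finite simple graphs admits an implicit representation if there are a constant $C$ and a function $D$ from pairs of binary words to $\{0,1\}$, both depending only on $\mathcal X$, such that for every $n$ and every $n$-vertex graph $G\in\mathcal X$ one can assign to each vertex $v$ of $G$ a binary word $\ell(v)$ of length at most $C\log_2 n$ so that, for all vertices $v,w$ of $G$, the vertices $v$ and $w$ are adjacent if and only if $D(\ell(v),\ell(w))=1$. **Theorem.** For all $t,p\ge 0$, the class of $F_{t,p}$-free bipartite graphs, that is, of the finite bipartite graphs with no induced subgraph isomorphic to $F_{t,p}$, admits an implicit representation. In particular, for every $t$ the class of $F_{t,t}$-free bipartite graphs admits an implicit representation. -/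

import Mathlib

universe u

/-- The `t + p + 4` vertices of the graph `F_{t,p}`. -/
inductive FVertex (t p : ℕ) : Type
  | centerX : FVertex t p
  | centerY : FVertex t p
  | x (i : Fin t) : FVertex t p
  | y (j : Fin p) : FVertex t p
  | common : FVertex t p
  | isolated : FVertex t p

/-- The edges of `F_{t,p}`, oriented from the two centres to their neighbours. -/
def FVertex.Rel {t p : ℕ} : FVertex t p → FVertex t p → Prop
  | .centerX, .x _ => True
  | .centerX, .common => True
  | .centerY, .y _ => True
  | .centerY, .common => True
  | _, _ => False

/-- The graph `F_{t,p}`: one centre is adjacent to `x₁, …, x_t`, the other centre is adjacent to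
`y₁, …, y_p`, both centres are adjacent to one further common neighbour, and there is one
isolated vertex; there are no other edges. -/
def graphF (t p : ℕ) : SimpleGraph (FVertex t p) :=
  SimpleGraph.fromRel FVertex.Rel

/-- A class `X` of graphs admits an implicit representation: there are a constant `C` and one
decoding function `D`, both depending only on the class, such that the vertices of every finite
graph in `X`, with `n` vertices, can be given binary codes of length at most `C * log₂ n` from
which `D` determines the adjacency of any two vertices. Only the finite members of `X` matter. -/
def AdmitsImplicitRepresentation (X : (V : Type u) → SimpleGraph V → Prop) : Prop :=
  ∃ (C : ℝ) (D : List Bool → List Bool → Bool),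
    ∀ (V : Type u) [Finite V] (G : SimpleGraph V), X V G →
      ∃ code : V → List Bool,
        (∀ v, ((code v).length : ℝ) ≤ C * Real.logb 2 (Nat.card V : ℝ)) ∧
        ∀ v w, G.Adj v w ↔ D (code v) (code w) = true

/-- The class of `F_{t,p}`-free bipartite graphs: the bipartite graphs with no induced subgraph
isomorphic to `F_{t,p}`. -/
def FFreeBipartite (t p : ℕ) (V : Type u) (G : SimpleGraph V) : Prop :=
  G.IsBipartite ∧ ¬ (graphF t p).IsIndContained G

/-! If two vertices on one side of an `F_{t,p}`-free bipartite graph have a common neighbour and a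
common non-neighbour across, then one neighbourhood contains the other up to max(t,p) elements. This
is `cross`, and it holds on both sides. It suffices to find universal relations of polynomial size
(`PolyUniversal`), since their vertices have names of O(log n) bits.

Polynomial universality survives complement, exchange of sides, Boolean combination and disjoint
unions. So `cross_cross` reduces through `laminar_cross`, `laminar_colaminar` and `nested_laminar`
to `nested_nested`: splitting around fixed or extremal vertices gives all neighbourhoods in a piece
a common element or a common non-element, which kills one alternative of the condition, and what is
left over is sparse or a rectangle.

In `nested_nested`, double counting yields in every induced subgraph a vertex with few neighbours or
few non-neighbours across (`exists_sparse_or_cosparse`). Eliminating such vertices one by one, each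
keeps a flag and a short list of exceptions, and ranks tell whose list decides a pair. -/

/-- A class of bipartite graphs, given by their adjacency relations between two sides. -/
abbrev BipartiteClass := ∀ A B : Type u, (A → B → Prop) → Prop

/-- The members of the class with sides of size at most `n` are all induced by one relation
of size polynomial in `n`. -/
def PolyUniversal (X : BipartiteClass.{u}) : Prop :=
  ∃ k : ℕ, ∀ n : ℕ, ∃ (U W : Type) (_ : Finite U) (_ : Finite W) (D : U → W → Prop),
    Nat.card U ≤ (n + 2) ^ k ∧ Nat.card W ≤ (n + 2) ^ k ∧
    ∀ (A B : Type u) [Finite A] [Finite B] (E : A → B → Prop),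
      Nat.card A ≤ n → Nat.card B ≤ n → X A B E →
      ∃ (f : A → U) (g : B → W), ∀ a b, E a b ↔ D (f a) (g b)

namespace BipartiteClass

/-- The class of complements. -/
def compl (X : BipartiteClass.{u}) : BipartiteClass.{u} :=
  fun A B E => X A B (fun a b => ¬ E a b)

/-- The class with the two sides exchanged. -/
def swap (X : BipartiteClass.{u}) : BipartiteClass.{u} :=
  fun A B E => X B A (fun b a => E a b)

/-- The pointwise combinations of a member of `X` and a member of `Y` by a connective. -/
def combine (op : Prop → Prop → Prop) (X Y : BipartiteClass.{u}) : BipartiteClass.{u} :=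
  fun A B E => ∃ E₁ E₂ : A → B → Prop, X A B E₁ ∧ Y A B E₂ ∧ ∀ a b, E a b ↔ op (E₁ a b) (E₂ a b)

/-- Disjoint unions of members of `X`, together with isolated vertices. -/
def blocks (X : BipartiteClass.{u}) : BipartiteClass.{u} :=
  fun A B E => ∃ (ι : Type u) (_ : Finite ι) (α : A → Option ι) (β : B → Option ι),
    Nat.card ι ≤ Nat.card A + 1 ∧
    (∀ a b, E a b → ∃ i, α a = some i ∧ β b = some i) ∧
    ∀ i, X {a // α a = some i} {b // β b = some i} (fun a b => E a b)

/-- Every vertex of the first side has at most `t` neighbours. -/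
def sparse (t : ℕ) : BipartiteClass.{u} :=
  fun _ _ E => ∀ a, {b | E a b}.ncard ≤ t

/-- Adjacency is the product of two sets. -/
def rectangle : BipartiteClass.{u} :=
  fun A B E => ∃ (P : A → Prop) (Q : B → Prop), ∀ a b, E a b ↔ P a ∧ Q b

/-- Adjacency is a comparison of ranks. -/
def threshold : BipartiteClass.{u} :=
  fun A B E => ∃ (r : A → ℕ) (s : B → ℕ), (∀ a, r a ≤ Nat.card A + Nat.card B) ∧
    (∀ b, s b ≤ Nat.card A + Nat.card B) ∧ ∀ a b, E a b ↔ r a < s b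

end BipartiteClass

open BipartiteClass

/-! ### Closure properties and basic examples of polynomial universality -/

namespace PolyUniversal

variable {X Y : BipartiteClass.{u}}

theorem mono (hY : PolyUniversal Y)
    (h : ∀ (A B : Type u) [Finite A] [Finite B] (E : A → B → Prop), X A B E → Y A B E) :
    PolyUniversal X := by
  obtain ⟨k, hk⟩ := hY
  refine ⟨k, fun n => ?_⟩
  obtain ⟨U, W, hU, hW, D, cU, cW, hD⟩ := hk n
  exact ⟨U, W, hU, hW, D, cU, cW, fun A B _ _ E hA hB hX => hD A B E hA hB (h A B E hX)⟩

theorem compl (hX : PolyUniversal X) : PolyUniversal X.compl := by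
  obtain ⟨k, hk⟩ := hX
  refine ⟨k, fun n => ?_⟩
  obtain ⟨U, W, hU, hW, D, cU, cW, hD⟩ := hk n
  refine ⟨U, W, hU, hW, fun u w => ¬ D u w, cU, cW, fun A B _ _ E hA hB hX => ?_⟩
  obtain ⟨f, g, h⟩ := hD A B _ hA hB hX
  exact ⟨f, g, fun a b => not_iff_not.1 ((h a b).trans not_not.symm)⟩

theorem swap (hX : PolyUniversal X) : PolyUniversal X.swap := by
  obtain ⟨k, hk⟩ := hX
  refine ⟨k, fun n => ?_⟩
  obtain ⟨U, W, hU, hW, D, cU, cW, hD⟩ := hk n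
  refine ⟨W, U, hW, hU, fun w u => D u w, cW, cU, fun A B _ _ E hA hB hX => ?_⟩
  obtain ⟨f, g, h⟩ := hD B A _ hB hA hX
  exact ⟨g, f, fun a b => h b a⟩

theorem combine (hX : PolyUniversal X) (hY : PolyUniversal Y) (op : Prop → Prop → Prop) :
    PolyUniversal (combine op X Y) := by
  obtain ⟨k, hk⟩ := hX
  obtain ⟨l, hl⟩ := hY
  refine ⟨k + l, fun n => ?_⟩
  obtain ⟨U, W, hU, hW, D, cU, cW, hD⟩ := hk n
  obtain ⟨U', W', hU', hW', D', cU', cW', hD'⟩ := hl n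
  refine ⟨U × U', W × W', inferInstance, inferInstance,
    fun u w => op (D u.1 w.1) (D' u.2 w.2), ?_, ?_, fun A B _ _ E hA hB hX => ?_⟩
  · rw [Nat.card_prod, pow_add]; exact Nat.mul_le_mul cU cU'
  · rw [Nat.card_prod, pow_add]; exact Nat.mul_le_mul cW cW'
  · obtain ⟨E₁, E₂, h₁, h₂, h⟩ := hX
    obtain ⟨f, g, e⟩ := hD A B _ hA hB h₁
    obtain ⟨f', g', e'⟩ := hD' A B _ hA hB h₂
    exact ⟨fun a => (f a, f' a), fun b => (g b, g' b), fun a b => by rw [h, e, e']⟩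

theorem exists_injective_fin {ι : Type*} [Finite ι] {n : ℕ} (h : Nat.card ι ≤ n) :
    ∃ e : ι → Fin n, Function.Injective e :=
  ⟨fun i => Fin.castLE h (Finite.equivFin ι i),
    (Fin.castLE_injective h).comp (Finite.equivFin ι).injective⟩

theorem blocks (hX : PolyUniversal X) : PolyUniversal X.blocks := by
  obtain ⟨k, hk⟩ := hX
  refine ⟨k + 1, fun n => ?_⟩
  obtain ⟨U, W, hU, hW, D, cU, cW, hD⟩ := hk n
  have hcard : ∀ (T : Type) [Finite T], Nat.card T ≤ (n + 2) ^ k →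
      Nat.card (Option (Fin (n + 1) × T)) ≤ (n + 2) ^ (k + 1) := by
    intro T _ hT
    -- This pays for the extra point `none`: (n+1)q + 1 ≤ (n+2)q once q ≥ 1.
    have h1 : 1 ≤ (n + 2) ^ k := Nat.one_le_pow _ _ (by omega)
    rw [Finite.card_option, Nat.card_prod, Nat.card_fin, pow_succ]
    nlinarith
  refine ⟨Option (Fin (n + 1) × U), Option (Fin (n + 1) × W), inferInstance, inferInstance,
    fun u w => ∃ j x y, u = some (j, x) ∧ w = some (j, y) ∧ D x y, hcard U cU, hcard W cW,
    fun A B _ _ E hA hB hX => ?_⟩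
  obtain ⟨ι, _, α, β, hι, hE, hX⟩ := hX
  obtain ⟨e, he⟩ := exists_injective_fin (hι.trans (Nat.add_le_add_right hA 1))
  have hsub : ∀ (A : Type u) [Finite A] (P : A → Prop), Nat.card A ≤ n →
      Nat.card {a // P a} ≤ n := fun A _ P h =>
    (Nat.card_le_card_of_injective _ Subtype.val_injective).trans h
  choose f g hfg using fun i => hD _ _ _ (hsub A _ hA) (hsub B _ hB) (hX i)
  have hext : ∀ {A : Type u} {T : Type} (α : A → Option ι) (f : ∀ i, {a // α a = some i} → T) (a : A),
      ∃ u : Option (Fin (n + 1) × T), (α a = none → u = none) ∧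
        ∀ i (h : α a = some i), u = some (e i, f i ⟨a, h⟩) := by
    intro A T α f a
    rcases Option.eq_none_or_eq_some (α a) with h | ⟨i, h⟩
    · exact ⟨none, by simp [h]⟩
    · refine ⟨some (e i, f i ⟨a, h⟩), by simp [h], fun j hj => ?_⟩
      obtain rfl := Option.some.inj (h.symm.trans hj)
      rfl
  choose f' hf0 hf' using hext α f
  choose g' hg0 hg' using hext β g
  refine ⟨f', g', fun a b => ⟨fun hab => ?_, ?_⟩⟩
  · obtain ⟨i, ha, hb⟩ := hE a b hab
    exact ⟨e i, _, _, hf' a i ha, hg' b i hb, (hfg i ⟨a, ha⟩ ⟨b, hb⟩).1 hab⟩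
  · rintro ⟨j, x, y, hx, hy, hxy⟩
    cases ha : α a with
    | none => rw [hf0 a ha] at hx; cases hx
    | some i =>
      cases hb : β b with
      | none => rw [hg0 b hb] at hy; cases hy
      | some i' =>
        rw [hf' a i ha] at hx
        rw [hg' b i' hb] at hy
        obtain ⟨h1, rfl⟩ := Prod.mk.inj (Option.some.inj hx)
        obtain ⟨h2, rfl⟩ := Prod.mk.inj (Option.some.inj hy)
        obtain rfl := he (h1.trans h2.symm)
        exact (hfg i ⟨a, ha⟩ ⟨b, hb⟩).2 hxy

/-- A vertex of the first side is sent to the list of its neighbours, padded with `none` to length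
t. The exponent is t + 1 so that it also bounds the second side when t = 0. -/
theorem sparse (t : ℕ) : PolyUniversal (sparse.{u} t) := by
  refine ⟨t + 1, fun n => ⟨Fin t → Option (Fin n), Fin n, inferInstance, inferInstance,
    fun u w => ∃ i, u i = some w, ?_, ?_, fun A B _ _ E hA hB hE => ?_⟩⟩
  · rw [Nat.card_fun, Nat.card_fin, Finite.card_option, Nat.card_fin]
    exact (Nat.pow_le_pow_left (by omega) t).trans (Nat.pow_le_pow_right (by omega) (by omega))
  · rw [Nat.card_fin]
    exact le_trans (by omega) (Nat.le_self_pow (by omega) (n + 2))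
  · obtain ⟨e, he⟩ := exists_injective_fin hB
    have hlist : ∀ a, ∃ l : List B, l.length ≤ t ∧ ∀ b, b ∈ l ↔ E a b := by
      intro a
      refine ⟨(Set.toFinite {b | E a b}).toFinset.toList, ?_, fun b => by simp⟩
      rw [Finset.length_toList, ← Set.ncard_eq_toFinset_card]
      exact hE a
    choose l hl hmem using hlist
    refine ⟨fun a i => ((l a)[(i : ℕ)]?).map e, e, fun a b => ?_⟩
    rw [← hmem, List.mem_iff_getElem?]
    constructor
    · rintro ⟨i, hi⟩
      obtain ⟨hlt, -⟩ := List.getElem?_eq_some_iff.1 hi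
      exact ⟨⟨i, hlt.trans_le (hl a)⟩, by simp [hi]⟩
    · rintro ⟨i, hi⟩
      obtain ⟨b', hb', hbb⟩ := Option.map_eq_some_iff.1 hi
      exact ⟨i, he hbb ▸ hb'⟩

theorem rectangle : PolyUniversal rectangle.{u} := by
  refine ⟨1, fun n => ⟨Prop, Prop, inferInstance, inferInstance, fun p q => p ∧ q, ?_, ?_,
    fun A B _ _ E _ _ ⟨P, Q, h⟩ => ⟨P, Q, h⟩⟩⟩ <;>
  · rw [Nat.card_eq_fintype_card, Fintype.card_prop, pow_one]; omega

theorem threshold : PolyUniversal threshold.{u} := by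
  have hc (n : ℕ) : Nat.card (Fin (2 * n + 1)) ≤ (n + 2) ^ 2 := by
    rw [Nat.card_fin]; nlinarith
  refine ⟨2, fun n => ⟨Fin (2 * n + 1), Fin (2 * n + 1), inferInstance, inferInstance,
    fun p q => p < q, hc n, hc n, ?_⟩⟩
  rintro A B _ _ E hA hB ⟨r, s, hr, hs, h⟩
  exact ⟨fun a => ⟨r a, by have := hr a; omega⟩, fun b => ⟨s b, by have := hs b; omega⟩,
    fun a b => h a b⟩

end PolyUniversal

/-! ### Almost nested sets and the hierarchy of neighbourhood conditions -/

/-- One of the two sets is contained in the other up to at most `t` elements. -/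
def AlmostNested {β : Type*} (t : ℕ) (S T : Set β) : Prop :=
  (S \ T).ncard ≤ t ∨ (T \ S).ncard ≤ t

/-- The smaller set has the smaller difference, so either alternative bounds it. Comparison with an
extremal vertex thus always has a known direction. -/
theorem AlmostNested.ncard_diff_le {β : Type*} [Finite β] {t : ℕ} {S T : Set β}
    (h : AlmostNested t S T) (hST : S.ncard ≤ T.ncard) : (S \ T).ncard ≤ t :=
  h.elim id ((Set.ncard_le_ncard_iff_ncard_sdiff_le_ncard_sdiff S.toFinite T.toFinite).1 hST).trans

theorem Set.ncard_preimage_le_of_injective {α β : Type*} [Finite β] {f : α → β}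
    (hf : Function.Injective f) (S : Set β) : (f ⁻¹' S).ncard ≤ S.ncard := by
  rw [← Set.ncard_image_of_injective _ hf]
  exact Set.ncard_le_ncard (Set.image_preimage_subset f S)

theorem AlmostNested.preimage {α β : Type*} [Finite β] {t : ℕ} {S T : Set β}
    (h : AlmostNested t S T) {f : α → β} (hf : Function.Injective f) :
    AlmostNested t (f ⁻¹' S) (f ⁻¹' T) :=
  h.imp (Set.ncard_preimage_le_of_injective hf _).trans
    (Set.ncard_preimage_le_of_injective hf _).trans

theorem AlmostNested.compl {β : Type*} {t : ℕ} {S T : Set β}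
    (h : AlmostNested t S T) : AlmostNested t Sᶜ Tᶜ := by
  unfold AlmostNested
  rw [compl_sdiff_compl, compl_sdiff_compl]
  exact h.symm

namespace BipartiteClass

variable {A B A' B' : Type u} {E : A → B → Prop} {t : ℕ}

/-- The neighbourhoods of the vertices of the first side are pairwise almost nested. -/
def nested (t : ℕ) : BipartiteClass.{u} :=
  fun _ _ E => ∀ a a', AlmostNested t {b | E a b} {b | E a' b}

/-- The neighbourhoods of the vertices of the first side are pairwise disjoint or almost nested. -/
def laminar (t : ℕ) : BipartiteClass.{u} :=
  fun _ _ E => ∀ a a', (∀ b, E a b → ¬ E a' b) ∨ AlmostNested t {b | E a b} {b | E a' b}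

/-- The neighbourhoods of the vertices of the first side pairwise cover the second side or are
almost nested. -/
def colaminar (t : ℕ) : BipartiteClass.{u} :=
  fun _ _ E => ∀ a a', (∀ b, E a b ∨ E a' b) ∨ AlmostNested t {b | E a b} {b | E a' b}

/-- The neighbourhoods of the vertices of the first side pairwise are disjoint, cover the second
side, or are almost nested. -/
def cross (t : ℕ) : BipartiteClass.{u} :=
  fun _ _ E => ∀ a a', (∀ b, E a b → ¬ E a' b) ∨ (∀ b, E a b ∨ E a' b) ∨
    AlmostNested t {b | E a b} {b | E a' b}

theorem nested.comap [Finite B] (h : nested t A B E) (f : A' → A) {g : B' → B}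
    (hg : Function.Injective g) : nested t A' B' (fun a b => E (f a) (g b)) :=
  fun a a' => (h (f a) (f a')).preimage hg

theorem laminar.comap [Finite B] (h : laminar t A B E) (f : A' → A) {g : B' → B}
    (hg : Function.Injective g) : laminar t A' B' (fun a b => E (f a) (g b)) :=
  fun a a' => (h (f a) (f a')).imp (fun h b => h (g b)) (·.preimage hg)

theorem colaminar.comap [Finite B] (h : colaminar t A B E) (f : A' → A) {g : B' → B}
    (hg : Function.Injective g) : colaminar t A' B' (fun a b => E (f a) (g b)) :=
  fun a a' => (h (f a) (f a')).imp (fun h b => h (g b)) (·.preimage hg)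

theorem cross.comap [Finite B] (h : cross t A B E) (f : A' → A) {g : B' → B}
    (hg : Function.Injective g) : cross t A' B' (fun a b => E (f a) (g b)) :=
  fun a a' => (h (f a) (f a')).imp (fun h b => h (g b))
    (Or.imp (fun h b => h (g b)) (·.preimage hg))

theorem nested.compl (h : nested t A B E) : nested t A B (fun a b => ¬ E a b) :=
  fun a a' => (h a a').compl

theorem colaminar.compl (h : colaminar t A B E) : laminar t A B (fun a b => ¬ E a b) :=
  fun a a' => (h a a').imp (fun h b hb hb' => (h b).elim hb hb') (·.compl)

theorem cross.compl (h : cross t A B E) : cross t A B (fun a b => ¬ E a b) := by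
  intro a a'
  rcases h a a' with h | h | h
  · exact Or.inr (Or.inl fun b => not_or_of_imp (h b))
  · exact Or.inl fun b hb hb' => (h b).elim hb hb'
  · exact Or.inr (Or.inr h.compl)

/-- An element common to all neighbourhoods excludes disjointness; one missing from all excludes
covering. This and the next two lemmas drive every reduction below. -/
theorem laminar.nested (h : laminar t A B E) {b : B} (hb : ∀ a, E a b) : nested t A B E :=
  fun a a' => (h a a').resolve_left fun h => h b (hb a) (hb a')

theorem cross.colaminar (h : cross t A B E) {b : B} (hb : ∀ a, E a b) : colaminar t A B E :=
  fun a a' => (h a a').resolve_left fun h => h b (hb a) (hb a')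

theorem cross.laminar (h : cross t A B E) {b : B} (hb : ∀ a, ¬ E a b) : laminar t A B E :=
  fun a a' => (h a a').imp_right fun h => h.resolve_left fun h => (h b).elim (hb a) (hb a')

end BipartiteClass

/-! ### Elimination orders and the doubly nested case -/

/-- If every nonempty set of vertices has an element that is good for it, then the vertices can be
ranked such that each is good for the set of those ranked up to it. -/
theorem exists_elimination_order {V : Type*} [Finite V] (P : V → Set V → Prop)
    (h : ∀ S : Set V, S.Nonempty → ∃ v ∈ S, P v S) :
    ∃ r : V → ℕ, (∀ v, r v ≤ Nat.card V) ∧ ∀ v, P v {w | r w ≤ r v} := by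
  classical
  suffices H : ∀ n, ∀ S : Set V, S.ncard = n → ∃ r : V → ℕ, (∀ v ∈ S, r v ≤ n) ∧
      ∀ v ∈ S, P v {w | w ∈ S ∧ r w ≤ r v} by
    obtain ⟨r, h1, h3⟩ := H _ Set.univ rfl
    exact ⟨r, fun v => Set.ncard_univ V ▸ h1 v trivial,
      fun v => by simpa using h3 v trivial⟩
  intro n
  induction n with
  | zero =>
    intro S hS
    obtain rfl := (Set.ncard_eq_zero).1 hS
    exact ⟨fun _ => 0, by simp⟩
  | succ n ih =>
    intro S hS
    -- The vertex good for all of S gets the top rank n + 1; the rest are ranked by induction.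
    obtain ⟨v, hv, hP⟩ := h S ((Set.ncard_pos).1 (by omega))
    obtain ⟨r, h1, h3⟩ := ih (S \ {v}) (by rw [Set.ncard_sdiff_singleton_of_mem hv, hS]; rfl)
    have hr : ∀ w ∈ S, w ≠ v → Function.update r v (n + 1) w = r w ∧ r w ≤ n :=
      fun w hw hne => ⟨Function.update_of_ne hne _ _, h1 w ⟨hw, hne⟩⟩
    have hrv : Function.update r v (n + 1) v = n + 1 := Function.update_self ..
    refine ⟨Function.update r v (n + 1), fun w hw => ?_, fun w hw => ?_⟩
    · by_cases hne : w = v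
      · rw [hne, hrv]
      · have := hr w hw hne; omega
    · by_cases hne : w = v
      · subst hne
        convert hP using 1
        ext x
        refine ⟨fun hx => hx.1, fun hx => ⟨hx, ?_⟩⟩
        by_cases hxw : x = w
        · rw [hxw]
        · have := hr x hx hxw; omega
      · convert h3 w ⟨hw, hne⟩ using 1
        ext x
        by_cases hxv : x = v
        · subst hxv
          have := hr w hw hne
          constructor
          · rintro ⟨-, hle⟩; omega
          · rintro ⟨⟨-, hx⟩, -⟩; exact absurd rfl hx
        · constructor
          · rintro ⟨hx, hle⟩
            exact ⟨⟨hx, hxv⟩, by rwa [(hr x hx hxv).1, (hr w hw hne).1] at hle⟩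
          · rintro ⟨⟨hx, -⟩, hle⟩
            exact ⟨hx, by rwa [(hr x hx hxv).1, (hr w hw hne).1]⟩

namespace BipartiteClass

variable {A B : Type u} {E : A → B → Prop} {t : ℕ}

/-- In a nonempty graph that is almost nested on both sides, some vertex is almost isolated or
almost complete to the other side. -/
theorem exists_sparse_or_cosparse [Finite A] [Finite B] [Nonempty A] [Nonempty B]
    (hA : nested t A B E) (hB : (nested t).swap A B E) :
    (∃ a, {b | E a b}.ncard ≤ 2 * t) ∨ ∃ b, {a | ¬ E a b}.ncard ≤ 2 * t := by
  classical
  -- Otherwise take 2t+1 neighbours Q of a row m of least degree and 2t+1 non-neighbours R of a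
  -- column y of greatest degree. Every row misses at most t of Q, so meets at least t+1; every
  -- column meets at most t of R. Counting edges between R and Q gives (2t+1)(t+1) ≤ (2t+1)t.
  by_contra! h
  obtain ⟨m, hm⟩ := Finite.exists_min fun a => {b | E a b}.ncard
  obtain ⟨y, hy⟩ := Finite.exists_max fun b => {a | E a b}.ncard
  obtain ⟨Q, hQm, hQ⟩ := Set.exists_subset_card_eq (Nat.succ_le_of_lt (h.1 m))
  obtain ⟨R, hRy, hR⟩ := Set.exists_subset_card_eq (Nat.succ_le_of_lt (h.2 y))
  have hrow : ∀ r, (Q \ {b | E r b}).ncard ≤ t := fun r =>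
    (Set.ncard_le_ncard (Set.sdiff_subset_sdiff_left hQm)).trans ((hA m r).ncard_diff_le (hm r))
  have hcol : ∀ q, (R ∩ {a | E a q}).ncard ≤ t := fun q =>
    (Set.ncard_le_ncard (t := {a | E a q} \ {a | E a y})
      fun a ha => ⟨ha.2, hRy ha.1⟩).trans ((hB q y).ncard_diff_le (hy q))
  have key := Finset.card_mul_le_card_mul (s := R.toFinite.toFinset) (t := Q.toFinite.toFinset)
    E (m := t + 1) (n := t) (fun a _ => ?_) (fun b _ => ?_)
  · rw [← Set.ncard_eq_toFinset_card, ← Set.ncard_eq_toFinset_card, hQ, hR] at key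
    nlinarith
  · have h1 := hrow a
    have h2 := Set.ncard_inter_add_ncard_sdiff_eq_ncard Q {b | E a b}
    have h3 : (Q ∩ {b | E a b}).ncard =
        (Finset.bipartiteAbove E Q.toFinite.toFinset a).card := by
      rw [← Set.ncard_coe_finset]; congr 1; ext; simp
    omega
  · have h1 := hcol b
    have h3 : (R ∩ {a | E a b}).ncard =
        (Finset.bipartiteBelow E R.toFinite.toFinset b).card := by
      rw [← Set.ncard_coe_finset]; congr 1; ext; simp
    omega

end BipartiteClass

namespace PolyUniversal

/-- Graphs that are almost nested on both sides. -/
theorem nested_nested (t : ℕ) :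
    PolyUniversal (fun A B E => nested.{u} t A B E ∧ (nested t).swap A B E) := by
  have hrow : PolyUniversal (BipartiteClass.combine Xor .rectangle (.sparse (2 * t))) :=
    rectangle.combine (sparse.{u} (2 * t)) Xor
  have hcol := rectangle.combine (sparse.{u} (2 * t)).swap Xor
  refine ((threshold.combine hcol (· ∧ ·)).combine
    (threshold.combine hrow (¬ · ∧ ·)) (· ∨ ·)).mono ?_
  rintro A B _ _ E ⟨hA, hB⟩
  -- The flag p is the default adjacency: `False` for few neighbours in S, `True` for few
  -- non-neighbours. The set counts the exceptions.
  let P : A ⊕ B → Set (A ⊕ B) → Prop := fun v S => v.elim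
    (fun a => ∃ p : Prop, {b | Sum.inr b ∈ S ∧ Xor p (E a b)}.ncard ≤ 2 * t)
    (fun b => ∃ p : Prop, {a | Sum.inl a ∈ S ∧ Xor p (E a b)}.ncard ≤ 2 * t)
  obtain ⟨r, hr, hrP⟩ := exists_elimination_order P (fun S hS => by
    by_cases h1 : ∃ a, Sum.inl a ∈ S
    · obtain ⟨a, ha⟩ := h1
      by_cases h2 : ∃ b, Sum.inr b ∈ S
      · obtain ⟨b, hb⟩ := h2
        have : Nonempty {a : A // Sum.inl a ∈ S} := ⟨a, ha⟩
        have : Nonempty {b : B // Sum.inr b ∈ S} := ⟨b, hb⟩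
        rcases exists_sparse_or_cosparse
          (hA.comap (Subtype.val : {a : A // Sum.inl a ∈ S} → A)
            (Subtype.val_injective : Function.Injective (Subtype.val : {b : B // Sum.inr b ∈ S} → B)))
          (nested.comap hB (Subtype.val : {b : B // Sum.inr b ∈ S} → B)
            (Subtype.val_injective : Function.Injective (Subtype.val : {a : A // Sum.inl a ∈ S} → A)))
          with ⟨a, ha⟩ | ⟨b, hb⟩
        · refine ⟨.inl a, a.2, False, ?_⟩
          rw [← Set.ncard_image_of_injective _ Subtype.val_injective] at ha
          refine (Set.ncard_le_ncard ?_).trans ha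
          rintro b ⟨hb, hab⟩
          exact ⟨⟨b, hb⟩, by simpa [Xor] using hab, rfl⟩
        · refine ⟨.inr b, b.2, True, ?_⟩
          rw [← Set.ncard_image_of_injective _ Subtype.val_injective] at hb
          refine (Set.ncard_le_ncard ?_).trans hb
          rintro a ⟨ha, hab⟩
          exact ⟨⟨a, ha⟩, by simpa [Xor] using hab, rfl⟩
      · refine ⟨.inl a, ha, False, ?_⟩
        convert Nat.zero_le _
        rw [Set.ncard_eq_zero]
        ext b
        simpa using fun h => absurd ⟨b, h⟩ h2
    · obtain ⟨a | b, hv⟩ := hS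
      · exact absurd ⟨a, hv⟩ h1
      · refine ⟨.inr b, hv, False, ?_⟩
        convert Nat.zero_le _
        rw [Set.ncard_eq_zero]
        ext a
        simpa using fun h => absurd ⟨a, h⟩ h1)
  choose p hp using fun a => (hrP (.inl a) : ∃ _, _)
  choose q hq using fun b => (hrP (.inr b) : ∃ _, _)
  have hcard : Nat.card (A ⊕ B) = Nat.card A + Nat.card B := Nat.card_sum
  have hT : BipartiteClass.threshold A B fun a b => r (.inl a) < r (.inr b) :=
    ⟨_, _, fun a => hcard ▸ hr (.inl a), fun b => hcard ▸ hr (.inr b), fun _ _ => Iff.rfl⟩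
  have hE : ∀ x e : Prop, Xor x (Xor x e) ↔ e := by intro x e; simp only [Xor]; tauto
  -- The endpoint of higher rank decides, the row in case of a tie. Its exceptions are cut down to
  -- vertices ranked no higher, which makes them sparse; a second `Xor` with the flag restores E.
  refine ⟨_, _, ⟨_, fun a b => Xor (q b) (r (.inl a) ≤ r (.inr b) ∧ Xor (q b) (E a b)), hT,
      ⟨_, _, ⟨fun _ => True, q, fun a b => (true_and _).symm.to_iff⟩, hq, fun _ _ => Iff.rfl⟩,
      fun _ _ => Iff.rfl⟩,
    ⟨_, fun a b => Xor (p a) (r (.inr b) ≤ r (.inl a) ∧ Xor (p a) (E a b)), hT,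
      ⟨_, _, ⟨p, fun _ => True, fun a b => (and_true _).symm.to_iff⟩, hp, fun _ _ => Iff.rfl⟩,
      fun _ _ => Iff.rfl⟩, fun a b => ?_⟩
  by_cases h : r (.inl a) < r (.inr b)
  · simp [h, h.le, hE]
  · simp [h, not_lt.1 h, hE]

end PolyUniversal

/-! ### Reduction of the cross condition to the doubly nested case -/

namespace BipartiteClass

variable {A B : Type u} {E : A → B → Prop} {t : ℕ}

/-- The restriction of a relation to a product of two sets is a single block. -/
theorem blocks_restrict {X : BipartiteClass.{u}} (E : A → B → Prop) (P : A → Prop) (Q : B → Prop)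
    (hX : X {a // P a} {b // Q b} (fun a b => E a b)) :
    blocks X A B (fun a b => E a b ∧ P a ∧ Q b) := by
  classical
  refine ⟨PUnit, inferInstance, fun a => if P a then some .unit else none,
    fun b => if Q b then some .unit else none, by simp, fun a b h => ⟨.unit, ?_⟩, fun i => ?_⟩
  · simp [h.2]
  · have h1 : (fun a => (if P a then some PUnit.unit else none) = some i) = P := by
      ext a; simp
    have h2 : (fun b => (if Q b then some PUnit.unit else none) = some i) = Q := by
      ext b; simp
    have H : ∀ (P' : A → Prop) (Q' : B → Prop), P' = P → Q' = Q →
        X {a // P' a} {b // Q' b} (fun a b => E a b ∧ P a ∧ Q b) := by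
      rintro _ _ rfl rfl
      convert hX using 3 with a b
      exact and_iff_left ⟨a.2, b.2⟩
    exact H _ _ h1 h2

/-- In a laminar graph there are vertices of the first side with disjoint neighbourhoods such that
every other neighbourhood meets one of these and is almost contained in it. -/
theorem laminar.exists_leaders [Finite A] [Finite B] (h : laminar t A B E) :
    ∃ L : Set A, (∀ l ∈ L, ∀ l' ∈ L, l ≠ l' → ∀ b, E l b → ¬ E l' b) ∧
      ∀ a, (∃ b, E a b) → ∃ l ∈ L, (∃ b, E a b ∧ E l b) ∧ {b | E a b ∧ ¬ E l b}.ncard ≤ t := by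
  suffices H : ∀ n, ∀ S : Set A, S.ncard = n → (∀ a ∈ S, ∃ b, E a b) → ∃ L ⊆ S,
      (∀ l ∈ L, ∀ l' ∈ L, l ≠ l' → ∀ b, E l b → ¬ E l' b) ∧
      ∀ a ∈ S, ∃ l ∈ L, (∃ b, E a b ∧ E l b) ∧ {b | E a b ∧ ¬ E l b}.ncard ≤ t by
    obtain ⟨L, -, hL⟩ := H _ {a | ∃ b, E a b} rfl fun _ h => h
    exact ⟨L, hL⟩
  intro n
  induction n using Nat.strong_induction_on with
  | _ n ih =>
    intro S hS hne
    rcases S.eq_empty_or_nonempty with rfl | hSne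
    · exact ⟨∅, by simp⟩
    -- Neighbourhoods meeting that of m are almost inside it by maximality; those disjoint from it
    -- are left to the induction.
    obtain ⟨m, hm, hmax⟩ := Set.exists_max_image S (fun a => {b | E a b}.ncard) S.toFinite hSne
    obtain ⟨b₀, hb₀⟩ := hne m hm
    obtain ⟨L, hLS, hL, hdom⟩ := ih _ (hS ▸ Set.ncard_lt_ncard
      (show {a ∈ S | ∀ b, E m b → ¬ E a b} ⊂ S from
        ⟨fun a ha => ha.1, fun hsub => (hsub hm).2 b₀ hb₀ hb₀⟩)) _ rfl fun a ha => hne a ha.1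
    refine ⟨insert m L, Set.insert_subset hm (hLS.trans fun a ha => ha.1), ?_, fun a ha => ?_⟩
    · rintro l (rfl | hl) l' (rfl | hl') hll b hb hb'
      · exact hll rfl
      · exact (hLS hl').2 b hb hb'
      · exact (hLS hl).2 b hb' hb
      · exact hL l hl l' hl' hll b hb hb'
    · by_cases hd : ∀ b, E m b → ¬ E a b
      · obtain ⟨l, hl, hal⟩ := hdom a ⟨ha, hd⟩
        exact ⟨l, Or.inr hl, hal⟩
      · push Not at hd
        obtain ⟨b, hb, hb'⟩ := hd
        exact ⟨m, Or.inl rfl, ⟨b, hb', hb⟩,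
          ((h a m).resolve_left fun h => h b hb' hb).ncard_diff_le (hmax a ha)⟩

end BipartiteClass

namespace PolyUniversal

/-- Graphs that are almost nested on the first side and laminar on the second. -/
theorem nested_laminar (t : ℕ) :
    PolyUniversal (fun A B E => nested.{u} t A B E ∧ (laminar t).swap A B E) := by
  refine ((nested_nested t).blocks.combine (sparse t) (· ∨ ·)).mono ?_
  rintro A B _ _ E ⟨hA, hB⟩
  rcases isEmpty_or_nonempty A with _ | _
  · exact ⟨E, E, ⟨PUnit, inferInstance, isEmptyElim, fun _ => none, by simp, isEmptyElim,
      fun _ => ⟨fun a => isEmptyElim a.1, fun b => by cases b.2⟩⟩, isEmptyElim, isEmptyElim⟩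
  -- Edges outside the largest neighbourhood are sparse. Inside it all columns share m, so they are
  -- nested.
  obtain ⟨m, hm⟩ := Finite.exists_max fun a => {b | E a b}.ncard
  refine ⟨_, fun a b => E a b ∧ ¬ E m b, blocks_restrict E (fun _ => True) (E m) ?_,
    fun a => (hA a m).ncard_diff_le (hm a), fun a b => by tauto⟩
  exact ⟨hA.comap _ Subtype.val_injective,
    laminar.nested (laminar.comap hB _ Subtype.val_injective) (b := ⟨m, trivial⟩) fun b => b.2⟩

/-- Graphs that are laminar on the first side and colaminar on the second. -/
theorem laminar_colaminar (t : ℕ) :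
    PolyUniversal (fun A B E => laminar.{u} t A B E ∧ (colaminar t).swap A B E) := by
  refine (((nested_laminar t).compl.blocks.combine (sparse t).swap (· ∨ ·)).combine
    rectangle (· ∨ ·)).mono ?_
  rintro A B _ _ E ⟨hA, hB⟩
  rcases isEmpty_or_nonempty B with _ | _
  · exact ⟨E, E, ⟨E, E, ⟨PUnit, inferInstance, fun _ => none, isEmptyElim, by simp,
      fun _ b => isEmptyElim b, fun _ => ⟨fun a => (nomatch a.2), fun b => isEmptyElim b.1⟩⟩,
      fun b => isEmptyElim b, fun _ b => isEmptyElim b⟩,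
      ⟨fun _ => True, fun _ => True, fun _ b => isEmptyElim b⟩, fun _ b => isEmptyElim b⟩
  -- Rows adjacent to m share m, so they are nested, and the complement falls under
  -- `nested_laminar`. On the other rows, a column that covers A together with m is complete, giving
  -- a rectangle; any other column has at most t edges there.
  obtain ⟨m, hm⟩ := Finite.exists_max fun b => {a | E a b}.ncard
  refine ⟨_, fun a b => ¬ E a m ∧ (∀ a', E a' b ∨ E a' m),
    ⟨_, fun a b => (E a b ∧ ¬ E a m) ∧ ¬ ∀ a', E a' b ∨ E a' m,
      blocks_restrict E (fun a => E a m) (fun _ => True) ?_,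
      fun b => ?_, fun _ _ => Iff.rfl⟩, ⟨_, _, fun _ _ => Iff.rfl⟩, fun a b => ?_⟩
  · exact ⟨(laminar.nested (hA.comap (Subtype.val : {a // E a m} → A) Subtype.val_injective)
      (b := ⟨m, trivial⟩) fun a => a.2).compl,
      colaminar.compl (colaminar.comap hB _ Subtype.val_injective)⟩
  · by_cases hc : ∀ a', E a' b ∨ E a' m
    · simp [hc]
    · exact (Set.ncard_le_ncard fun a ha => ha.1).trans
        (((hB b m).resolve_left hc).ncard_diff_le (hm b))
  · have : (∀ a', E a' b ∨ E a' m) → E a b ∨ E a m := fun h => h a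
    dsimp only
    generalize (∀ a', E a' b ∨ E a' m) = q at *
    tauto

/-- Graphs that are laminar on the first side and cross-free on the second. -/
theorem laminar_cross (t : ℕ) :
    PolyUniversal (fun A B E => laminar.{u} t A B E ∧ (cross t).swap A B E) := by
  classical
  refine ((laminar_colaminar t).blocks.combine (sparse t) (· ∨ ·)).mono ?_
  rintro A B _ _ E ⟨hA, hB⟩
  -- Each leader c spans a block on its neighbourhood, whose columns all share c and so are
  -- colaminar. Edges leaving the leader's neighbourhood are sparse.
  obtain ⟨L, hL, hdom⟩ := hA.exists_leaders
  choose! l hlL hmeet hdiff using hdom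
  have hβ : ∀ b, ∃ o : Option A, ∀ c, o = some c ↔ c ∈ L ∧ E c b := by
    intro b
    by_cases h : ∃ c ∈ L, E c b
    · obtain ⟨c, hc, hcb⟩ := h
      refine ⟨some c, fun d => ⟨?_, fun hd => ?_⟩⟩
      · rintro ⟨⟩; exact ⟨hc, hcb⟩
      · by_contra hne
        exact hL c hc d hd.1 (fun h => hne (h ▸ rfl)) b hcb hd.2
    · exact ⟨none, fun d => ⟨nofun, fun hd => absurd ⟨d, hd⟩ h⟩⟩
  choose β hβ using hβ
  let α : A → Option A := fun a => if ∃ b, E a b then some (l a) else none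
  have hα : ∀ a c, α a = some c ↔ (∃ b, E a b) ∧ l a = c := by
    intro a c
    by_cases h : ∃ b, E a b <;> simp [α, h]
  refine ⟨fun a b => E a b ∧ E (l a) b, fun a b => E a b ∧ ¬ E (l a) b,
    ⟨A, inferInstance, α, β, Nat.le_succ _, fun a b h => ?_, fun c => ?_⟩, fun a => ?_,
    fun a b => by tauto⟩
  · exact ⟨l a, (hα _ _).2 ⟨⟨b, h.1⟩, rfl⟩, (hβ _ _).2 ⟨hlL a ⟨b, h.1⟩, h.2⟩⟩
  · have hE : (fun (a : {a // α a = some c}) (b : {b // β b = some c}) => E a b ∧ E (l a) b) =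
        fun (a : {a // α a = some c}) (b : {b // β b = some c}) => E a b := by
      ext a b
      refine and_iff_left ?_
      rw [((hα _ _).1 a.2).2]
      exact ((hβ _ _).1 b.2).2
    rw [hE]
    refine ⟨hA.comap _ Subtype.val_injective, ?_⟩
    have hBc := cross.comap hB (Subtype.val : {b // β b = some c} → B)
      (Subtype.val_injective : Function.Injective (Subtype.val : {a // α a = some c} → A))
    intro x y
    obtain ⟨hcL, hcx⟩ := (hβ _ _).1 x.2
    -- A leader must lie in its own block to serve as the common neighbour; it meets the leader
    -- assigned to it, so disjointness makes them equal.
    have hlc : l c = c := by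
      by_contra hne
      obtain ⟨b, hcb, hlb⟩ := hmeet c ⟨x, hcx⟩
      exact hL _ (hlL c ⟨x, hcx⟩) _ hcL hne b hlb hcb
    exact cross.colaminar hBc (b := ⟨c, (hα _ _).2 ⟨⟨x, hcx⟩, hlc⟩⟩)
      (fun b => ((hβ _ _).1 b.2).2) x y
  · by_cases h : ∃ b, E a b
    · exact hdiff a h
    · push Not at h
      simp [h]

/-- Graphs that are cross-free on both sides. -/
theorem cross_cross (t : ℕ) :
    PolyUniversal (fun A B E => cross.{u} t A B E ∧ (cross t).swap A B E) := by
  refine ((laminar_cross t).blocks.combine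
    ((laminar_cross t).compl.blocks) (· ∨ ·)).mono ?_
  rintro A B _ _ E ⟨hA, hB⟩
  rcases isEmpty_or_nonempty B with _ | ⟨⟨z⟩⟩
  · refine ⟨_, _, blocks_restrict E (fun _ => True) (fun _ => True)
      ⟨fun _ _ => Or.inl fun b => isEmptyElim b.1, fun b => isEmptyElim b.1⟩,
      blocks_restrict E (fun _ => True) (fun _ => True)
      ⟨fun _ _ => Or.inl fun b => isEmptyElim b.1, fun b => isEmptyElim b.1⟩,
      fun _ b => isEmptyElim b⟩
  have key : ∀ (P : A → Prop) (F : A → B → Prop), (∀ a, P a → ¬ F a z) → cross t A B F →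
      (cross t).swap A B F → laminar t {a // P a} {b : B // True} (fun a b => F a b) ∧
        (cross t).swap {a // P a} {b : B // True} (fun a b => F a b) := fun P F hz h1 h2 =>
    ⟨cross.laminar (h1.comap (Subtype.val : {a // P a} → A) Subtype.val_injective)
      (b := ⟨z, trivial⟩) fun a => hz a a.2, cross.comap h2 _ Subtype.val_injective⟩
  -- Rows avoiding z cannot cover, so they are laminar; rows through z become such after
  -- complementing.
  refine ⟨_, _, blocks_restrict E (fun a => ¬ E a z) (fun _ => True) ?_,
    blocks_restrict E (fun a => E a z) (fun _ => True) ?_,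
    fun a b => by tauto⟩
  · exact key _ E (fun _ h => h) hA hB
  · exact key _ (fun a b => ¬ E a b) (fun _ h => not_not.2 h) hA.compl (cross.compl hB)

end PolyUniversal

/-! ### From the forbidden subgraph to the cross condition -/

/-- Failure of `cross` supplies two centres, a common neighbour, a common non-neighbour to serve as
the isolated vertex, and more than max(t,p) private neighbours of each centre. -/
theorem graphF_isIndContained_of_not_cross {V : Type u} [Finite V] {G : SimpleGraph V} {t p : ℕ}
    {P Q : V → Prop} (hPQ : ∀ v, P v → ¬ Q v) (hP : ∀ v w, P v → P w → ¬ G.Adj v w)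
    (hQ : ∀ v w, Q v → Q w → ¬ G.Adj v w)
    (h : ¬ cross (max t p) {v // P v} {v // Q v} (fun a b => G.Adj a b)) :
    (graphF t p).IsIndContained G := by
  unfold cross AlmostNested at h
  push Not at h
  obtain ⟨a, a', ⟨c, hac, hac'⟩, ⟨d, had, had'⟩, hx, hy⟩ := h
  have hemb : ∀ {k : ℕ} {S : Set {v // Q v}}, k ≤ S.ncard →
      ∃ x : Fin k → {v // Q v}, Function.Injective x ∧ ∀ i, x i ∈ S := by
    intro k S hk
    exact ⟨fun i => (Finite.equivFin S).symm (Fin.castLE hk i), Subtype.val_injective.comp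
      ((Finite.equivFin S).symm.injective.comp (Fin.castLE_injective hk)), fun i => Subtype.coe_prop _⟩
  have haa : a ≠ a' := by
    rintro rfl
    simp at hx
  obtain ⟨x, hxi, hx⟩ := hemb ((le_max_left t p).trans hx.le)
  obtain ⟨y, hyi, hy⟩ := hemb ((le_max_right t p).trans hy.le)
  let φ : FVertex t p → V
    | .centerX => a
    | .centerY => a'
    | .x i => x i
    | .y j => y j
    | .common => c
    | .isolated => d
  have hQP : ∀ v w, Q v → P w → v ≠ w := fun v w hv hw e => hPQ w hw (e ▸ hv)
  have hPP : ∀ v w : {v // P v}, ¬ G.Adj v w := fun v w => hP v w v.2 w.2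
  have hQQ : ∀ v w : {v // Q v}, ¬ G.Adj v w := fun v w => hQ v w v.2 w.2
  have hPQ' : ∀ (v : {v // P v}) (w : {v // Q v}), (v : V) ≠ w :=
    fun v w e => hQP w v w.2 v.2 e.symm
  have hx1 : ∀ i, G.Adj a (x i) := fun i => (hx i).1
  have hx2 : ∀ i, ¬ G.Adj a' (x i) := fun i => (hx i).2
  have hy1 : ∀ i, G.Adj a' (y i) := fun i => (hy i).1
  have hy2 : ∀ i, ¬ G.Adj a (y i) := fun i => (hy i).2
  have hφ : Function.Injective φ := by
    rintro (_ | _ | i | i | _ | _) (_ | _ | j | j | _ | _) h <;> simp only [φ] at h <;>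
      first
      | rfl
      | exact congrArg _ (hxi (Subtype.ext h))
      | exact congrArg _ (hyi (Subtype.ext h))
      | exact absurd (Subtype.ext h) haa
      | exact absurd (Subtype.ext h.symm) haa
      | exact absurd h (hPQ' _ _)
      | exact absurd h.symm (hPQ' _ _)
      | have h₁ := congrArg (G.Adj a) h
        have h₂ := congrArg (G.Adj a') h
        simp [hac, hac', had, had', hx1, hx2, hy1, hy2] at h₁ h₂
  refine ⟨⟨⟨φ, hφ⟩, fun {u v} => ?_⟩⟩
  rcases u with (_ | _ | i | i | _ | _) <;> rcases v with (_ | _ | j | j | _ | _) <;>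
    simp [φ, graphF, FVertex.Rel, hac, hac', had, had', hx1, hx2, hy1, hy2, hPP, hQQ,
      hac.symm, hac'.symm, mt SimpleGraph.Adj.symm had, mt SimpleGraph.Adj.symm had', fun i => (hx1 i).symm,
      fun i => mt SimpleGraph.Adj.symm (hx2 i), fun i => (hy1 i).symm,
      fun i => mt SimpleGraph.Adj.symm (hy2 i)]

/-! ### Binary codes -/

theorem Nat.bits_inj {m n : ℕ} (h : m.bits = n.bits) : m = n :=
  Nat.eq_of_testBit_eq fun i => by rw [Nat.testBit_eq_inth, Nat.testBit_eq_inth, h]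

/-- For n ≥ 2, n + 2 ≤ n² puts x below n^(2k+1), and pairing roughly squares, giving at most
n^(4k+4). The length exceeds the logarithm by at most one bit, absorbed by log₂ n ≥ 1. -/
theorem length_bits_pair_le {k n x : ℕ} (hn : 2 ≤ n) (hx : x < 2 * (n + 2) ^ k) :
    ((Nat.pair n x).bits.length : ℝ) ≤ (4 * k + 5) * Real.logb 2 n := by
  have hn' : (2 : ℝ) ≤ n := by exact_mod_cast hn
  have hlog : 1 ≤ Real.logb 2 n := by
    rw [Real.le_logb_iff_rpow_le one_lt_two (by linarith), Real.rpow_one]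
    exact hn'
  have h1 : 2 * (n + 2) ^ k ≤ n ^ (2 * k + 1) := by
    rw [pow_succ', pow_mul]
    exact Nat.mul_le_mul hn (Nat.pow_le_pow_left (by nlinarith) k)
  have h2 : n ≤ n ^ (2 * k + 1) := Nat.le_self_pow (by omega) n
  have h3 : max n x + 1 ≤ n ^ (2 * k + 2) := by
    have h4 : 2 * n ^ (2 * k + 1) ≤ n ^ (2 * k + 2) := by
      rw [pow_succ' n (2 * k + 1)]
      exact Nat.mul_le_mul_right _ hn
    have h5 : max n x ≤ n ^ (2 * k + 1) := max_le h2 (hx.le.trans h1)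
    omega
  have hM : Nat.pair n x ≤ n ^ (4 * k + 4) := by
    refine (Nat.pair_lt_max_add_one_sq n x).le.trans ((Nat.pow_le_pow_left h3 2).trans_eq ?_)
    rw [← pow_mul]
    ring_nf
  rw [Nat.size_eq_bits_len]
  rcases Nat.eq_zero_or_pos (Nat.pair n x).size with h0 | h0
  · rw [h0]
    push_cast
    positivity
  · obtain ⟨s, hs⟩ := Nat.exists_eq_succ_of_ne_zero h0.ne'
    have hpow : 2 ^ s ≤ n ^ (4 * k + 4) := (Nat.lt_size.1 (by omega)).trans hM
    have hs' : (s : ℝ) ≤ (4 * k + 4) * Real.logb 2 n := by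
      have hle : Real.logb 2 ((2 : ℝ) ^ s) ≤ Real.logb 2 ((n : ℝ) ^ (4 * k + 4)) :=
        Real.logb_le_logb_of_le one_lt_two (by positivity) (by exact_mod_cast hpow)
      rw [Real.logb_pow, Real.logb_pow, Real.logb_self_eq_one one_lt_two, mul_one] at hle
      exact_mod_cast hle
    rw [hs]
    push_cast
    linarith

theorem mainTheorem1 (t p : ℕ) :
    AdmitsImplicitRepresentation.{u} (FFreeBipartite.{u} t p) := by
  classical
  obtain ⟨k, hk⟩ := PolyUniversal.cross_cross.{u} (max t p)
  choose U W hU hW D cU cW hD using hk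
  have he : ∀ n, ∃ e : U n ⊕ W n → ℕ, Function.Injective e ∧ ∀ x, e x < 2 * (n + 2) ^ k := by
    intro n
    have hc : Nat.card (U n ⊕ W n) ≤ 2 * (n + 2) ^ k := by
      rw [Nat.card_sum]
      have := cU n
      have := cW n
      omega
    obtain ⟨e, he⟩ := PolyUniversal.exists_injective_fin hc
    exact ⟨fun x => e x, Fin.val_injective.comp he, fun x => (e x).2⟩
  choose e hinj hlt using he
  let R : ∀ n, U n ⊕ W n → U n ⊕ W n → Prop := fun n x y =>
    (∃ u w, x = .inl u ∧ y = .inr w ∧ D n u w) ∨ (∃ u w, y = .inl u ∧ x = .inr w ∧ D n u w)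
  -- The code includes n, so that one decoder knows which universal relation to consult.
  refine ⟨4 * k + 5, fun l l' => decide (∃ n x y, 2 ≤ n ∧ l = (Nat.pair n (e n x)).bits ∧
    l' = (Nat.pair n (e n y)).bits ∧ R n x y), fun V _ G hG => ?_⟩
  obtain ⟨⟨c⟩, hfree⟩ := hG
  -- On one vertex log₂ n = 0 forces the empty word. The guard 2 ≤ n makes the decoder reject it,
  -- since a positive number has nonempty `bits`.
  rcases Nat.lt_or_ge (Nat.card V) 2 with hV | hV
  · have : Subsingleton V := Finite.card_le_one_iff_subsingleton.1 (by omega)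
    refine ⟨fun _ => [], fun v => ?_, fun v w => ?_⟩
    · have : Nonempty V := ⟨v⟩
      simp [Nat.card_unique]
    · have hvw : ¬ G.Adj v w := fun h => h.ne (Subsingleton.elim v w)
      simp only [hvw, false_iff, decide_eq_true_eq]
      rintro ⟨n, x, y, hn, hl, -⟩
      have h0 : Nat.pair n (e n x) = 0 := Nat.bits_inj (by rw [← hl, Nat.zero_bits])
      have := Nat.left_le_pair n (e n x)
      omega
  have hind : ∀ i v w, c v = i → c w = i → ¬ G.Adj v w := fun i v w hv hw h =>
    c.valid h (hv.trans hw.symm)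
  have hcross : ∀ i j, i ≠ j →
      cross (max t p) {v // c v = i} {v // c v = j} (fun a b => G.Adj a b) := fun i j hij => by
    by_contra h
    exact hfree (graphF_isIndContained_of_not_cross (fun v hi hj => hij (hi.symm.trans hj))
      (hind i) (hind j) h)
  have hsub : ∀ P : V → Prop, Nat.card {v // P v} ≤ Nat.card V := fun P =>
    Nat.card_le_card_of_injective _ Subtype.val_injective
  obtain ⟨f, g, hfg⟩ := hD (Nat.card V) {v // c v = 0} {v // c v = 1} (fun a b => G.Adj a b)
    (hsub _) (hsub _) ⟨hcross 0 1 (by decide), by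
      have h := hcross 1 0 (by decide)
      rwa [show (fun (a : {v // c v = 1}) (b : {v // c v = 0}) => G.Adj a b) =
        fun (a : {v // c v = 1}) (b : {v // c v = 0}) => G.Adj b a from funext₂ fun _ _ => propext (G.adj_comm _ _)] at h⟩
  have hc : ∀ v, c v = 0 ∨ c v = 1 := fun v => by
    have := (c v).isLt
    omega
  let ℓ : V → U (Nat.card V) ⊕ W (Nat.card V) := fun v =>
    if h : c v = 0 then .inl (f ⟨v, h⟩) else .inr (g ⟨v, (hc v).resolve_left h⟩)
  have hℓ0 : ∀ v (h : c v = 0), ℓ v = .inl (f ⟨v, h⟩) := fun v h => dif_pos h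
  have hℓ1 : ∀ v (h : c v = 1), ℓ v = .inr (g ⟨v, h⟩) := fun v h => dif_neg (by simp [h])
  have hR : ∀ v w, G.Adj v w ↔ R _ (ℓ v) (ℓ w) := by
    intro v w
    rcases hc v with hv | hv <;> rcases hc w with hw | hw
    · simp [R, hℓ0 v hv, hℓ0 w hw, hind 0 v w hv hw]
    · simpa [R, hℓ0 v hv, hℓ1 w hw] using hfg ⟨v, hv⟩ ⟨w, hw⟩
    · rw [G.adj_comm]
      simpa [R, hℓ1 v hv, hℓ0 w hw] using hfg ⟨w, hw⟩ ⟨v, hv⟩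
    · simp [R, hℓ1 v hv, hℓ1 w hw, hind 1 v w hv hw]
  refine ⟨fun v => (Nat.pair (Nat.card V) (e _ (ℓ v))).bits,
    fun v => length_bits_pair_le hV (hlt _ _), fun v w => ?_⟩
  rw [hR, decide_eq_true_eq]
  refine ⟨fun h => ⟨_, _, _, hV, rfl, rfl, h⟩, ?_⟩
  rintro ⟨n, x, y, -, hx, hy, hxy⟩
  obtain ⟨rfl, hx⟩ := Nat.pair_eq_pair.1 (Nat.bits_inj hx)
  obtain ⟨-, hy⟩ := Nat.pair_eq_pair.1 (Nat.bits_inj hy)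
  rwa [hinj _ hx, hinj _ hy]
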